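/- Let $\mathfrak A$ be a $C^*$-algebra, let $H$ be a Hilbert $\mathfrak A$-module, and let $\mathcal L(H)$ be the $C^*$-algebra of adjointable operators on $H$. For $B\in\mathcal L(H)$ put $|B|=(B^*B)^{1/2}$. We say that $B=U|B|$ is the polar decomposition of $B$ if $U\in\mathcal L(H)$ is a partial isometry such that $B=U|B|$ and $U^*U$ is the projection of $H$ onto $\overline{\mathcal R(B^*)}$, the closure of the range of $B^*$ (which is then an orthogonally complemented submodule). Write $[B,C]=BC-CB$. Let $T,A\in\mathcal L(H)$ have the polar decompositions $T=U_T|T|$ and $A=U_A|A|$, and suppose that $[|T|,A]=0$. For $\alpha,\beta>0$ put $$X^{\alpha,\beta}=|T|^{\alpha}AU_T|T|^{\beta},\qquad Y^{\alpha,\beta}=|T|^{\alpha}A|T^*|^{\beta},\qquad W=U_T^*U_TU_AU_T.$$ Then for all $\alpha,\beta>0$ the following statements are equivalent: (i) $X^{\alpha,\beta}=W|X^{\alpha,\beta}|$ is the polar decomposition of $X^{\alpha,\beta}$; (ii) $Y^{\alpha,\beta}=WU_T^*|Y^{\alpha,\beta}|$ is the polar decomposition of $Y^{\alpha,\beta}$;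 (iii) $X^{\alpha,\beta}=W|X^{\alpha,\beta}|$; (iv) $Y^{\alpha,\beta}=WU_T^*|Y^{\alpha,\beta}|$; (v) $|T|^{\alpha}\,|A|\,|T^*|^{\beta}$ is a positive element of $\mathcal L(H)$. If in addition $[|T^*|,|A|]=0$, and one of (i)--(v) holds for some pair $\alpha,\beta>0$, then all of (i)--(v) hold with $\alpha,\beta$ replaced by arbitrary $\alpha',\beta'>0$. -/

import Mathlib

noncomputable section

variable (𝔄 : Type*) [NonUnitalCStarAlgebra 𝔄] [PartialOrder 𝔄]
variable (H : Type*) [NormedAddCommGroup H] [NormedSpace ℂ H] [SMul 𝔄 H] [CStarModule 𝔄 H]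

/-- The operators `T` on a C⋆-module `H` over `𝔄` for which there is an operator `S` with
`⟪T x, y⟫ = ⟪x, S y⟫`, where `⟪·, ·⟫` is the `𝔄`-valued inner product. On a complete module, any two
functions satisfying this relation are automatically bounded linear maps. -/
def adjointableSubalgebra : Subalgebra ℂ (H →L[ℂ] H) where
  carrier := {T | ∃ S : H →L[ℂ] H, ∀ x y : H, inner 𝔄 (T x) y = inner 𝔄 x (S y)}
  mul_mem' := by
    rintro T₁ T₂ ⟨S₁, h₁⟩ ⟨S₂, h₂⟩
    exact ⟨S₂ * S₁, fun x y => by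
      simp only [_root_.mul_apply_eq_comp, h₁, h₂]⟩
  add_mem' := by
    rintro T₁ T₂ ⟨S₁, h₁⟩ ⟨S₂, h₂⟩
    exact ⟨S₁ + S₂, fun x y => by
      simp only [_root_.add_apply, CStarModule.inner_add_left,
        CStarModule.inner_add_right, h₁, h₂]⟩
  algebraMap_mem' := fun c => ⟨algebraMap ℂ _ (star c), fun x y => by
    simp only [Algebra.algebraMap_eq_smul_one, _root_.smul_apply,
      _root_.one_apply_eq_self, CStarModule.inner_smul_left_complex,
      CStarModule.inner_smul_right_complex]⟩

/-- The set `𝓛(H)` of adjointable operators on a Hilbert C⋆-module `H` over `𝔄`. -/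
def Adjointable : Type _ := adjointableSubalgebra 𝔄 H

namespace Adjointable

instance : NormedRing (Adjointable 𝔄 H) := inferInstanceAs (NormedRing (adjointableSubalgebra 𝔄 H))

instance : NormedAlgebra ℂ (Adjointable 𝔄 H) :=
  inferInstanceAs (NormedAlgebra ℂ (adjointableSubalgebra 𝔄 H))

variable {𝔄 H}

/-- The underlying bounded linear map. -/
def toCLM (T : Adjointable 𝔄 H) : H →L[ℂ] H := T.1

instance : CoeFun (Adjointable 𝔄 H) fun _ => H → H := ⟨fun T => T.toCLM⟩

theorem ext {S T : Adjointable 𝔄 H} (h : ∀ x, S x = T x) : S = T :=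
  Subtype.ext (ContinuousLinearMap.ext h)

theorem add_apply (S T : Adjointable 𝔄 H) (x : H) : (S + T) x = S x + T x := rfl

theorem mul_apply (S T : Adjointable 𝔄 H) (x : H) : (S * T) x = S (T x) := rfl

theorem smul_apply (c : ℂ) (T : Adjointable 𝔄 H) (x : H) : (c • T) x = c • T x := rfl

theorem norm_def (T : Adjointable 𝔄 H) : ‖T‖ = ‖T.toCLM‖ := rfl

theorem eq_of_inner_eq {y z : H} (h : ∀ x : H, inner 𝔄 x y = inner 𝔄 x z) : y = z := by
  have h0 : inner 𝔄 (y - z) (y - z) = 0 := by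
    rw [CStarModule.inner_sub_right, h, sub_self]
  exact sub_eq_zero.1 (CStarModule.inner_self.1 h0)

theorem exists_adjoint (T : Adjointable 𝔄 H) :
    ∃ S : Adjointable 𝔄 H, ∀ x y : H, inner 𝔄 (T x) y = inner 𝔄 x (S y) := by
  obtain ⟨S, hS⟩ := T.2
  refine ⟨⟨S, T.1, fun x y => ?_⟩, hS⟩
  rw [← CStarModule.star_inner, ← hS y x, CStarModule.star_inner]

/-- `star T` is the adjoint of `T`. -/
instance : Star (Adjointable 𝔄 H) := ⟨fun T => T.exists_adjoint.choose⟩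

theorem inner_apply_left (T : Adjointable 𝔄 H) (x y : H) :
    inner 𝔄 (T x) y = inner 𝔄 x ((star T) y) :=
  T.exists_adjoint.choose_spec x y

theorem eq_star {S T : Adjointable 𝔄 H}
    (h : ∀ x y : H, inner 𝔄 (T x) y = inner 𝔄 x (S y)) : star T = S :=
  ext fun y => eq_of_inner_eq (𝔄 := 𝔄) fun x => by rw [← inner_apply_left, h]

theorem star_star' (T : Adjointable 𝔄 H) : star (star T) = T :=
  eq_star fun x y => by
    rw [← CStarModule.star_inner, ← inner_apply_left, CStarModule.star_inner]

instance : StarRing (Adjointable 𝔄 H) where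
  star_involutive := star_star'
  star_mul S T := eq_star fun x y => by
    simp only [mul_apply, inner_apply_left]
  star_add S T := eq_star fun x y => by
    simp only [add_apply, inner_apply_left, CStarModule.inner_add_left,
      CStarModule.inner_add_right]

instance : StarModule ℂ (Adjointable 𝔄 H) where
  star_smul c T := eq_star fun x y => by
    simp only [smul_apply, inner_apply_left, CStarModule.inner_smul_left_complex,
      CStarModule.inner_smul_right_complex]

variable [StarOrderedRing 𝔄]

instance : CStarRing (Adjointable 𝔄 H) where
  norm_mul_self_le T := by
    have h : ‖T‖ ≤ √‖star T * T‖ := by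
      refine ContinuousLinearMap.opNorm_le_bound _ (Real.sqrt_nonneg _) fun x => ?_
      refine le_of_sq_le_sq ?_ (by positivity)
      calc ‖T x‖ ^ 2 = ‖inner 𝔄 (T x) (T x)‖ := CStarModule.norm_sq_eq 𝔄
        _ = ‖inner 𝔄 x ((star T * T) x)‖ := by rw [inner_apply_left, mul_apply]
        _ ≤ ‖x‖ * ‖(star T * T) x‖ := CStarModule.norm_inner_le H
        _ ≤ ‖x‖ * (‖star T * T‖ * ‖x‖) := by
          gcongr
          exact (star T * T).toCLM.le_opNorm x
        _ = (√‖star T * T‖ * ‖x‖) ^ 2 := by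
          rw [mul_pow, Real.sq_sqrt (norm_nonneg _)]; ring
    calc ‖T‖ * ‖T‖ ≤ √‖star T * T‖ * √‖star T * T‖ := by gcongr
      _ = ‖star T * T‖ := Real.mul_self_sqrt (norm_nonneg _)

instance [CompleteSpace H] : CompleteSpace (Adjointable 𝔄 H) := by
  refine Metric.complete_of_cauchySeq_tendsto fun u hu => ?_
  have hiso : Isometry (toCLM : Adjointable 𝔄 H → H →L[ℂ] H) := isometry_subtype_coe
  obtain ⟨T, hT⟩ := cauchySeq_tendsto_of_complete (hiso.uniformContinuous.comp_cauchySeq hu)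
  obtain ⟨S, hS⟩ := cauchySeq_tendsto_of_complete (hiso.uniformContinuous.comp_cauchySeq
    ((starₗᵢ ℂ : Adjointable 𝔄 H ≃ₗᵢ⋆[ℂ] _).isometry.uniformContinuous.comp_cauchySeq hu))
  have happ : ∀ (x : H), Continuous fun V : H →L[ℂ] H => V x := fun x => by fun_prop
  refine ⟨⟨T, S, fun x y => ?_⟩, hiso.isEmbedding.tendsto_nhds_iff.2 hT⟩
  have h1 := ((CStarModule.continuous_inner (A := 𝔄) (E := H)).comp
    ((happ x).prodMk (continuous_const (y := y)))).tendsto T |>.comp hT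
  have h2 := ((CStarModule.continuous_inner (A := 𝔄) (E := H)).comp
    ((continuous_const (y := x)).prodMk (happ y))).tendsto S |>.comp hS
  exact tendsto_nhds_unique (h1.congr fun n => inner_apply_left (u n) x y) h2

/-- `𝓛(H)` is a C⋆-algebra. -/
instance [CompleteSpace H] : CStarAlgebra (Adjointable 𝔄 H) where

/-- `0 ≤ T` means that `T` is a positive element of the C⋆-algebra `𝓛(H)`. -/
instance [CompleteSpace H] : PartialOrder (Adjointable 𝔄 H) := CStarAlgebra.spectralOrder _

instance [CompleteSpace H] : StarOrderedRing (Adjointable 𝔄 H) :=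
  CStarAlgebra.spectralOrderedRing _

end Adjointable

variable {𝔄 H}

/-- `P` is the projection of `H` onto `M`: a self-adjoint idempotent with range `M`. It exists if and
only if `M` is an orthogonally complemented closed submodule, and is then unique. -/
structure IsProjectionOnto (P : Adjointable 𝔄 H) (M : Set H) : Prop where
  isStarProjection : IsStarProjection P
  range_eq : Set.range ⇑P.toCLM = M

variable [StarOrderedRing 𝔄] [CompleteSpace H]

/-- `T = U|T|` is the polar decomposition of `T`, where `|T|` is the positive square root of `T⋆T`:
`U` is a partial isometry such that `U⋆U` is the projection onto the closure of the range of `T⋆`. -/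
structure IsPolarDecomposition (T U : Adjointable 𝔄 H) : Prop where
  partialIsometry : U * star U * U = U
  eq_mul_abs : T = U * CFC.abs T
  projection : IsProjectionOnto (star U * U) (closure (Set.range ⇑(star T).toCLM))

/-- `X^{α,β} = |T|^α A U_T |T|^β`. -/
def operatorX (T A UT : Adjointable 𝔄 H) (α β : ℝ) : Adjointable 𝔄 H :=
  CFC.abs T ^ α * A * UT * CFC.abs T ^ β

/-- `Y^{α,β} = |T|^α A |T⋆|^β`. -/
def operatorY (T A : Adjointable 𝔄 H) (α β : ℝ) : Adjointable 𝔄 H :=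
  CFC.abs T ^ α * A * CFC.abs (star T) ^ β

/-- `W_{T,A} = U_T⋆ U_T U_A U_T`. -/
def operatorW (UT UA : Adjointable 𝔄 H) : Adjointable 𝔄 H :=
  star UT * UT * UA * UT

end

/-! Write `P = U_T⋆U_T`, `Q = U_A⋆U_A`, `Z = |T|^α |A| |T⋆|^β`. Since `|T|` commutes with `A`, it
also commutes with `A⋆`, `|A|`, `U_A` and `Q`, and `P` commutes with `U_A` and `Q`; so `e = PQ` is a
projection.

Equations: `Y = U_A Z` and `QZ = Z`, so `|Y| = |Z|`, and multiplying (iv) by `U_A⋆` gives `Z =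
e|Z|`. This forces `Z = |Z|` (`CFC.eq_abs_of_eq_projection_mul_abs`), which is (v); the converse is
direct (`operatorY_eq_iff`). Since `X U_T⋆ = Y` and `Y U_T = X`, (iii) and (iv) are the same
equation (`operatorX_eq_iff`).

Projections: a product of two positive elements is positive only if they commute, so (v) makes
`|T⋆|` commute with `|T|^α |A|`, and `U_T U_T⋆` with `e`. Then `W⋆W = U_T⋆ e U_T` and `(W U_T⋆)⋆(W
U_T⋆) = U_T U_T⋆ e` are projections. Their ranges are found by a calculus of closed ranges: a right
factor may be replaced by any operator with the same closed range, and `a`, `a^r` have the same one.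

Change of exponents: if also `[|T⋆|, |A|] = 0`, then (v) gives that `|T|^α` commutes with `|T⋆|Q`, a
condition that does not depend on `α > 0`. -/

namespace CFC

/-! ### Functional calculus in a C⋆-algebra. -/

open scoped NNReal

variable {R : Type*} [CStarAlgebra R]

/-- Intertwining relations pass to the continuous functional calculus. -/
theorem mul_cfc_eq_cfc_mul {a b u : R} (ha : IsSelfAdjoint a) (hb : IsSelfAdjoint b)
    (h : u * a = b * u) {f : ℝ → ℝ} (hf : Continuous f) : u * cfc f a = cfc f b * u := by
  obtain ⟨M, hM⟩ : ∃ M : ℝ, spectrum ℝ a ∪ spectrum ℝ b ⊆ Set.Icc (-M) M := by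
    obtain ⟨M, hM⟩ := ((spectrum.isCompact a).union
      (spectrum.isCompact b)).isBounded.subset_closedBall (0 : ℝ)
    exact ⟨M, by simpa [Real.closedBall_eq_Icc] using hM⟩
  have key : ∀ p : Polynomial ℝ, u * Polynomial.aeval a p = Polynomial.aeval b p * u := by
    intro p
    induction p using Polynomial.induction_on' with
    | add p q hp hq => simp only [map_add, mul_add, add_mul, hp, hq]
    | monomial n c =>
      have hn : u * a ^ n = b ^ n * u := by
        induction n with
        | zero => simp
        | succ n ih => rw [pow_succ, ← mul_assoc, ih, mul_assoc, h, ← mul_assoc, ← pow_succ]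
      simp only [Polynomial.aeval_monomial, ← Algebra.smul_def, mul_smul_comm, smul_mul_assoc, hn]
  have near : ∀ (c : R), IsSelfAdjoint c → spectrum ℝ c ⊆ Set.Icc (-M) M →
      ∀ ε : ℝ, 0 < ε → ∀ p : Polynomial ℝ,
        (∀ x ∈ Set.Icc (-M) M, |p.eval x - f x| < ε) → ‖Polynomial.aeval c p - cfc f c‖ ≤ ε := by
    intro c hc hs ε hε p hp
    rw [← cfc_polynomial p c, ← cfc_sub _ _ c]
    exact norm_cfc_le hε.le fun x hx => (hp x (hs hx)).le
  rw [← sub_eq_zero, ← norm_le_zero_iff]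
  refine le_of_forall_pos_le_add fun δ hδ => ?_
  -- The two approximation errors contribute at most `2‖u‖η ≤ δ`; the `+ 1` covers `u = 0`.
  obtain ⟨p, hp⟩ := exists_polynomial_near_of_continuousOn (-M) M f hf.continuousOn
    (δ / (2 * (‖u‖ + 1))) (by positivity)
  have h1 := near a ha (Set.subset_union_left.trans hM) _ (by positivity) p hp
  have h2 := near b hb (Set.subset_union_right.trans hM) _ (by positivity) p hp
  have e : u * cfc f a - cfc f b * u = (Polynomial.aeval b p - cfc f b) * u
      - u * (Polynomial.aeval a p - cfc f a) := by
    rw [mul_sub, sub_mul, key p]; abel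
  set η := δ / (2 * (‖u‖ + 1)) with hη
  have hη' : η * (2 * (‖u‖ + 1)) = δ := by rw [hη]; field_simp
  have hη0 : 0 < η := by positivity
  calc ‖u * cfc f a - cfc f b * u‖ ≤ η * ‖u‖ + ‖u‖ * η := by
        rw [e]
        refine (norm_sub_le _ _).trans (add_le_add ?_ ?_)
        · exact (norm_mul_le _ _).trans (by gcongr)
        · exact (norm_mul_le _ _).trans (by gcongr)
    _ ≤ 0 + δ := by nlinarith

variable [PartialOrder R] [StarOrderedRing R]

/-- With positive exponents no invertibility of `a` is needed. -/
theorem rpow_add_of_pos {a : R} {x y : ℝ} (hx : 0 < x) (hy : 0 < y) :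
    a ^ (x + y) = a ^ x * a ^ y := by
  lift x to ℝ≥0 using hx.le
  lift y to ℝ≥0 using hy.le
  rw [NNReal.coe_pos] at hx hy
  rw [← NNReal.coe_add, ← nnrpow_eq_rpow hx, ← nnrpow_eq_rpow hy, ← nnrpow_eq_rpow (add_pos hx hy),
    nnrpow_add hx hy]

theorem commute_rpow_left {a b : R} (h : Commute a b) (r : ℝ) : Commute (a ^ r) b :=
  h.cfc_nnreal _

theorem commute_of_rpow_left {a b : R} (ha : 0 ≤ a) {r : ℝ} (hr : 0 < r)
    (h : Commute (a ^ r) b) : Commute a b := by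
  have := commute_rpow_left h r⁻¹
  rwa [rpow_rpow_of_exponent_nonneg a r r⁻¹ hr.le (inv_pos.2 hr).le, mul_inv_cancel₀ hr.ne',
    rpow_one a] at this

theorem mul_rpow_eq_rpow_mul {a b u : R} (ha : 0 ≤ a) (hb : 0 ≤ b) (h : u * a = b * u)
    {r : ℝ} (hr : 0 < r) : u * a ^ r = b ^ r * u := by
  rw [rpow_eq_cfc_real, rpow_eq_cfc_real]
  exact mul_cfc_eq_cfc_mul (.of_nonneg ha) (.of_nonneg hb) h (Real.continuous_rpow_const hr.le)

/-- The approximant is `h * h * (h + ε/2)⁻¹`: on the spectrum it differs from `h` by `(ε/2) · x/(x +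
ε/2) ≤ ε/2`. -/
theorem mem_closure_range_mul_self_mul {h : R} (hh : 0 ≤ h) :
    h ∈ closure (Set.range fun x : R => h * h * x) := by
  rw [Metric.mem_closure_range_iff]
  intro ε hε
  have hs : ∀ x ∈ spectrum ℝ h, 0 ≤ x := fun x hx => spectrum_nonneg_of_nonneg hh hx
  have hc : ContinuousOn (fun x : ℝ => (x + ε / 2)⁻¹) (spectrum ℝ h) :=
    ContinuousOn.inv₀ (by fun_prop) fun x hx => by have := hs x hx; positivity
  refine ⟨cfc (fun x : ℝ => (x + ε / 2)⁻¹) h, ?_⟩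
  have e : h - h * h * cfc (fun x : ℝ => (x + ε / 2)⁻¹) h
      = cfc (fun x : ℝ => x - x * x * (x + ε / 2)⁻¹) h := by
    rw [cfc_sub (fun x : ℝ => x) _ h, cfc_mul (fun x : ℝ => x * x) _ h,
      cfc_mul (fun x : ℝ => x) (fun x : ℝ => x) h, cfc_id' ℝ h]
  rw [dist_eq_norm, e]
  refine lt_of_le_of_lt (norm_cfc_le (c := ε / 2) (by positivity) fun x hx => ?_) (half_lt_self hε)
  have h0 := hs x hx
  have : x - x * x * (x + ε / 2)⁻¹ = ε / 2 * (x / (x + ε / 2)) := by field_simp; ring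
  rw [this, Real.norm_of_nonneg (by positivity)]
  exact mul_le_of_le_one_right (by positivity) ((div_le_one (by positivity)).2 (by linarith))

/-- If `z = e * |z|` for a projection `e`, then `z` is positive. -/
theorem eq_abs_of_eq_projection_mul_abs {e z : R} (he : IsStarProjection e)
    (h : z = e * abs z) : z = abs z := by
  have hn : star (abs z) = abs z := (abs_nonneg z).star_eq
  -- Both sides are `z⋆z`, the left one computed from `z = e|z|`. Hence `(1 - e)|z|` has zero square
  -- modulus.
  have h1 : abs z * e * abs z = abs z * abs z := by
    conv_rhs => rw [abs_mul_abs, h]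
    rw [star_mul, hn, he.isSelfAdjoint.star_eq]
    simp only [mul_assoc]
    rw [← mul_assoc e e, he.isIdempotentElem.eq]
  have h2 : (1 - e) * abs z = 0 := by
    rw [← CStarRing.star_mul_self_eq_zero_iff, star_mul, hn, star_sub, star_one,
      he.isSelfAdjoint.star_eq]
    have : (1 - e) * (1 - e) = 1 - e := he.isIdempotentElem.one_sub.eq
    rw [mul_assoc, ← mul_assoc (1 - e), this, sub_mul, one_mul, mul_sub, ← mul_assoc, h1, sub_self]
  rw [sub_mul, one_mul, sub_eq_zero] at h2
  rw [← h2] at h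
  exact h

end CFC

/-! ### Calculus of closed ranges. -/

namespace Adjointable

variable {𝔄 : Type*} [NonUnitalCStarAlgebra 𝔄] [PartialOrder 𝔄]
variable {H : Type*} [NormedAddCommGroup H] [NormedSpace ℂ H] [SMul 𝔄 H] [CStarModule 𝔄 H]

/-- The closure of the range of an adjointable operator. -/
def closedRange (S : Adjointable 𝔄 H) : Set H := closure (Set.range ⇑S.toCLM)

theorem apply_mem_closedRange (S : Adjointable 𝔄 H) (x : H) : S x ∈ closedRange S :=
  subset_closure ⟨x, rfl⟩

theorem closedRange_subset {S : Adjointable 𝔄 H} {M : Set H} (hM : IsClosed M)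
    (h : ∀ x, S x ∈ M) : closedRange S ⊆ M :=
  closure_minimal (Set.range_subset_iff.2 h) hM

theorem closedRange_mul_subset (S T : Adjointable 𝔄 H) : closedRange (S * T) ⊆ closedRange S :=
  closedRange_subset isClosed_closure fun x => apply_mem_closedRange S (T x)

theorem closedRange_mul_subset_mul {S T T' : Adjointable 𝔄 H}
    (h : closedRange T ⊆ closedRange T') : closedRange (S * T) ⊆ closedRange (S * T') := by
  refine closedRange_subset isClosed_closure fun x => ?_
  have h1 : T x ∈ closure (Set.range ⇑T'.toCLM) := h (apply_mem_closedRange T x)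
  have h2 := image_closure_subset_closure_image S.toCLM.continuous (Set.mem_image_of_mem _ h1)
  rwa [← Set.range_comp] at h2

theorem closedRange_mul_congr (S : Adjointable 𝔄 H) {T T' : Adjointable 𝔄 H}
    (h : closedRange T = closedRange T') : closedRange (S * T) = closedRange (S * T') :=
  (closedRange_mul_subset_mul h.subset).antisymm (closedRange_mul_subset_mul h.superset)

/-- Kernels are closed. This replaces cancellation: an operator that kills `|A|` also kills the
projection `U_A⋆U_A`. -/
theorem mul_eq_zero_of_closedRange_subset {S T X : Adjointable 𝔄 H}
    (h : closedRange T ⊆ closedRange S) (hX : X * S = 0) : X * T = 0 := by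
  have hc : IsClosed {y : H | X y = 0} := isClosed_eq X.toCLM.continuous continuous_const
  have hS : closedRange S ⊆ {y : H | X y = 0} :=
    closedRange_subset hc fun x => by
      change (X * S) x = 0
      rw [hX]; rfl
  exact ext fun x => hS (h (apply_mem_closedRange T x))

theorem closedRange_subset_of_mem_closure {S T : Adjointable 𝔄 H}
    (h : T ∈ closure (Set.range fun X => S * X)) : closedRange T ⊆ closedRange S := by
  refine closedRange_subset isClosed_closure fun x => ?_
  have hc : Continuous fun V : Adjointable 𝔄 H => V x :=
    (ContinuousLinearMap.apply ℂ H x).continuous.comp continuous_subtype_val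
  refine closure_mono ?_ (image_closure_subset_closure_image hc (Set.mem_image_of_mem _ h))
  rintro _ ⟨_, ⟨X, rfl⟩, rfl⟩
  exact ⟨X x, rfl⟩

/-- The range of an idempotent is its set of fixed points, which is closed. -/
theorem range_eq_closedRange {P : Adjointable 𝔄 H} (hP : IsIdempotentElem P) :
    Set.range ⇑P.toCLM = closedRange P := by
  refine subset_closure.antisymm (closure_minimal subset_rfl ?_)
  have : Set.range ⇑P.toCLM = {y : H | P y = y} := by
    ext y
    constructor
    · rintro ⟨x, rfl⟩
      change (P * P) x = P x
      rw [hP.eq]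
    · exact fun h => ⟨y, h⟩
  rw [this]
  exact isClosed_eq P.toCLM.continuous continuous_id

theorem isProjectionOnto_closedRange_iff [StarOrderedRing 𝔄] {P S : Adjointable 𝔄 H} :
    IsProjectionOnto P (closure (Set.range ⇑S.toCLM)) ↔
      IsStarProjection P ∧ closedRange P = closedRange S := by
  constructor
  · rintro ⟨h1, h2⟩
    exact ⟨h1, (range_eq_closedRange h1.isIdempotentElem).symm.trans h2⟩
  · rintro ⟨h1, h2⟩
    exact ⟨h1, (range_eq_closedRange h1.isIdempotentElem).trans h2⟩

theorem projection_mul_eq {P S : Adjointable 𝔄 H} (hP : IsIdempotentElem P)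
    (h : closedRange S ⊆ closedRange P) : P * S = S := by
  have : (1 - P) * S = 0 := mul_eq_zero_of_closedRange_subset h (by
    rw [sub_mul, one_mul, hP.eq, sub_self])
  rw [sub_mul, one_mul, sub_eq_zero] at this
  exact this.symm

/-- An operator that commutes, together with its adjoint, with `S` commutes with the projection onto
the closure of the range of `S`. -/
theorem commute_projection [StarOrderedRing 𝔄] {P S C : Adjointable 𝔄 H} (hP : IsStarProjection P)
    (h : closedRange P = closedRange S) (h1 : Commute C S) (h2 : Commute (star C) S) :
    Commute C P := by
  -- `D` maps the range of `S` into itself, so `PDP = DP`. The case `D = C⋆`, after taking adjoints,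
  -- gives `PCP = PC`.
  have key : ∀ D : Adjointable 𝔄 H, Commute D S → P * (D * P) = D * P := fun D hD => by
    refine projection_mul_eq hP.isIdempotentElem ?_
    rw [closedRange_mul_congr D h, hD.eq, h]
    exact closedRange_mul_subset S D
  have e1 := key C h1
  have e2 := congrArg star (key _ h2)
  simp only [star_mul, star_star, hP.isSelfAdjoint.star_eq] at e2
  rw [mul_assoc] at e2
  exact e1.symm.trans e2

variable [StarOrderedRing 𝔄] [CompleteSpace H]

theorem closedRange_mul_self {a : Adjointable 𝔄 H} (ha : 0 ≤ a) :
    closedRange (a * a) = closedRange a :=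
  (closedRange_mul_subset a a).antisymm
    (closedRange_subset_of_mem_closure (CFC.mem_closure_range_mul_self_mul ha))

theorem closedRange_rpow_anti {a : Adjointable 𝔄 H} {r s : ℝ} (hr : 0 < r) (h : r ≤ s) :
    closedRange (a ^ s) ⊆ closedRange (a ^ r) := by
  obtain rfl | h := h.eq_or_lt
  · rfl
  · rw [← add_sub_cancel r s, CFC.rpow_add_of_pos hr (sub_pos.2 h)]
    exact closedRange_mul_subset _ _

theorem closedRange_rpow_subset {a : Adjointable 𝔄 H} {r s : ℝ} (hr : 0 < r) (hs : 0 < s) :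
    closedRange (a ^ r) ⊆ closedRange (a ^ s) := by
  -- Squaring a positive operator keeps its closed range, so the exponent can be doubled until it
  -- exceeds `s`; beyond that, larger exponents give smaller ranges.
  have key : ∀ n : ℕ, closedRange (a ^ (2 ^ n * r)) = closedRange (a ^ r) := by
    intro n
    induction n with
    | zero => simp
    | succ n ih =>
      have h0 : 0 < 2 ^ n * r := by positivity
      rw [← ih, pow_succ, mul_right_comm, mul_two, CFC.rpow_add_of_pos h0 h0,
        closedRange_mul_self (CFC.rpow_nonneg (a := a))]
  obtain ⟨n, hn⟩ := pow_unbounded_of_one_lt (s / r) (one_lt_two (α := ℝ))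
  rw [← key n]
  exact closedRange_rpow_anti hs ((div_lt_iff₀ hr).1 hn).le

theorem closedRange_rpow {a : Adjointable 𝔄 H} (ha : 0 ≤ a) {r : ℝ} (hr : 0 < r) :
    closedRange (a ^ r) = closedRange a := by
  conv_rhs => rw [← CFC.rpow_one a ha]
  exact (closedRange_rpow_subset hr one_pos).antisymm (closedRange_rpow_subset one_pos hr)

end Adjointable

/-! ### A single polar decomposition. -/

namespace IsPolarDecomposition

open Adjointable

variable {𝔄 : Type*} [NonUnitalCStarAlgebra 𝔄] [PartialOrder 𝔄] [StarOrderedRing 𝔄]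
variable {H : Type*} [NormedAddCommGroup H] [NormedSpace ℂ H] [SMul 𝔄 H] [CStarModule 𝔄 H]
  [CompleteSpace H] {T U : Adjointable 𝔄 H}

theorem isStarProjection (h : IsPolarDecomposition T U) : IsStarProjection (star U * U) :=
  h.projection.isStarProjection

theorem isStarProjection' (h : IsPolarDecomposition T U) : IsStarProjection (U * star U) where
  isIdempotentElem := by
    rw [IsIdempotentElem, ← mul_assoc, h.partialIsometry]
  isSelfAdjoint := .mul_star_self U

theorem closedRange_projection_eq_star (h : IsPolarDecomposition T U) :
    closedRange (star U * U) = closedRange (star T) :=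
  (isProjectionOnto_closedRange_iff.1 h.projection).2

theorem projection_mul_abs (h : IsPolarDecomposition T U) :
    star U * U * CFC.abs T = CFC.abs T := by
  have hP := h.isStarProjection
  set P := star U * U
  have h1 : (1 - P) * star T = 0 := by
    rw [sub_mul, one_mul, projection_mul_eq hP.isIdempotentElem
      h.closedRange_projection_eq_star.superset, sub_self]
  have h2 : (1 - P) * CFC.abs T = 0 := by
    rw [← CStarRing.mul_star_self_eq_zero_iff, star_mul, (CFC.abs_nonneg T).star_eq, mul_assoc,
      ← mul_assoc (CFC.abs T), CFC.abs_mul_abs, ← mul_assoc, ← mul_assoc, h1, zero_mul, zero_mul]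
  rw [sub_mul, one_mul, sub_eq_zero] at h2
  exact h2.symm

theorem abs_mul_projection (h : IsPolarDecomposition T U) :
    CFC.abs T * (star U * U) = CFC.abs T := by
  have := congrArg star h.projection_mul_abs
  rwa [star_mul, h.isStarProjection.isSelfAdjoint.star_eq, (CFC.abs_nonneg T).star_eq] at this

theorem star_eq (h : IsPolarDecomposition T U) : star T = CFC.abs T * star U := by
  conv_lhs => rw [h.eq_mul_abs, star_mul, (CFC.abs_nonneg T).star_eq]

theorem closedRange_projection (h : IsPolarDecomposition T U) :
    closedRange (star U * U) = closedRange (CFC.abs T) := by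
  refine subset_antisymm ?_ ?_
  · rw [h.closedRange_projection_eq_star, h.star_eq]
    exact closedRange_mul_subset _ _
  · rw [← h.projection_mul_abs]
    exact closedRange_mul_subset _ _

theorem closedRange_abs (h : IsPolarDecomposition T U) :
    closedRange (CFC.abs T) = closedRange (star T) :=
  h.closedRange_projection.symm.trans h.closedRange_projection_eq_star

/-- The left side is positive with square `T T⋆`, and positive square roots are unique. -/
theorem conj_eq_abs_star (h : IsPolarDecomposition T U) :
    U * CFC.abs T * star U = CFC.abs (star T) := by
  refine (CFC.sqrt_unique ?_ (star_right_conjugate_nonneg (CFC.abs_nonneg T) U)).symm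
  calc U * CFC.abs T * star U * (U * CFC.abs T * star U)
      = U * CFC.abs T * (star U * U * CFC.abs T) * star U := by simp only [mul_assoc]
    _ = U * CFC.abs T * (CFC.abs T * star U) := by rw [h.projection_mul_abs, mul_assoc]
    _ = star (star T) * star T := by rw [← h.eq_mul_abs, ← h.star_eq, star_star]

/-- Makes every fact about `|T|` and `U⋆U` available for `|T⋆|` and `U U⋆`. -/
protected theorem star (h : IsPolarDecomposition T U) :
    IsPolarDecomposition (star T) (star U) where
  partialIsometry := by
    rw [star_star, mul_assoc]
    simpa only [star_mul, star_star] using congrArg star h.partialIsometry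
  eq_mul_abs := by
    rw [← h.conj_eq_abs_star, ← mul_assoc, ← mul_assoc, h.projection_mul_abs, h.star_eq]
  projection := by
    rw [isProjectionOnto_closedRange_iff, star_star, star_star]
    refine ⟨h.isStarProjection', ?_⟩
    have h1 : closedRange T = closedRange U := by
      conv_lhs => rw [h.eq_mul_abs]
      rw [closedRange_mul_congr U h.closedRange_projection.symm, ← mul_assoc, h.partialIsometry]
    rw [h1]
    refine (closedRange_mul_subset _ _).antisymm ?_
    conv_lhs => rw [← h.partialIsometry]
    exact closedRange_mul_subset _ _

theorem projection_mul_abs_rpow (h : IsPolarDecomposition T U) {r : ℝ} (hr : 0 < r) :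
    star U * U * CFC.abs T ^ r = CFC.abs T ^ r := by
  refine projection_mul_eq h.isStarProjection.isIdempotentElem ?_
  rw [closedRange_rpow (CFC.abs_nonneg T) hr, h.closedRange_projection]

theorem abs_rpow_mul_projection (h : IsPolarDecomposition T U) {r : ℝ} (hr : 0 < r) :
    CFC.abs T ^ r * (star U * U) = CFC.abs T ^ r := by
  have := congrArg star (h.projection_mul_abs_rpow hr)
  rwa [star_mul, h.isStarProjection.isSelfAdjoint.star_eq, CFC.rpow_nonneg.star_eq] at this

theorem mul_abs_rpow (h : IsPolarDecomposition T U) {r : ℝ} (hr : 0 < r) :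
    U * CFC.abs T ^ r = CFC.abs (star T) ^ r * U := by
  refine CFC.mul_rpow_eq_rpow_mul (CFC.abs_nonneg _) (CFC.abs_nonneg _) ?_ hr
  rw [← h.conj_eq_abs_star, mul_assoc, mul_assoc, h.abs_mul_projection]

end IsPolarDecomposition

/-! ### Partial isometries and absolute values in a C⋆-algebra. -/

section CStarAlgebra

variable {R : Type*} [CStarAlgebra R]

theorem mul_star_mul_self_of_isStarProjection {v : R} (h : IsStarProjection (star v * v)) :
    v * star v * v = v := by
  have hp : star v * v * (1 - star v * v) = 0 := by
    rw [mul_sub, mul_one, h.isIdempotentElem.eq, sub_self]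
  have : star (v * (1 - star v * v)) * (v * (1 - star v * v)) = 0 := by
    rw [star_mul, mul_assoc, ← mul_assoc (star v), hp, mul_zero]
  rw [CStarRing.star_mul_self_eq_zero_iff, mul_sub, mul_one, sub_eq_zero, ← mul_assoc] at this
  exact this.symm

theorem isStarProjection_conj {u e : R} (hu : u * star u * u = u) (he : IsStarProjection e)
    (h : Commute (u * star u) e) : IsStarProjection (star u * e * u) where
  isIdempotentElem := by
    calc star u * e * u * (star u * e * u) = star u * e * ((u * star u) * e) * u := by
          simp only [mul_assoc]
      _ = star u * (e * e) * (u * star u * u) := by rw [h.eq]; simp only [mul_assoc]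
      _ = star u * e * u := by rw [hu, he.isIdempotentElem.eq]
  isSelfAdjoint := by
    rw [IsSelfAdjoint, star_mul, star_mul, star_star, he.isSelfAdjoint.star_eq, mul_assoc]

variable [PartialOrder R] [StarOrderedRing R]

namespace CFC

theorem projection_mul_abs {p z : R} (hp : IsStarProjection p) (h : z * p = z) :
    p * abs z = abs z := by
  have hn : star (abs z) = abs z := (abs_nonneg z).star_eq
  have h1 : abs z * (1 - p) = 0 := by
    rw [← CStarRing.star_mul_self_eq_zero_iff, star_mul, hn, mul_assoc, ← mul_assoc (abs z),
      abs_mul_abs, mul_assoc, mul_sub z, h, mul_one, sub_self, mul_zero, mul_zero]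
  have h2 := congrArg star h1
  rw [star_mul, star_sub, star_one, hn, hp.isSelfAdjoint.star_eq, sub_mul, one_mul, star_zero,
    sub_eq_zero] at h2
  exact h2.symm

/-- Again uniqueness of the positive square root; the hypothesis on `z` lets `u⋆u` be absorbed by
`|z|`. -/
theorem abs_mul_star {u z : R} (hu : IsStarProjection (star u * u)) (h : z * (star u * u) = z) :
    abs (z * star u) = u * abs z * star u := by
  refine sqrt_unique ?_ (star_right_conjugate_nonneg (abs_nonneg z) u)
  calc u * abs z * star u * (u * abs z * star u)
      = u * abs z * (star u * u * abs z) * star u := by simp only [mul_assoc]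
    _ = u * (abs z * abs z) * star u := by rw [projection_mul_abs hu h, mul_assoc u]
    _ = star (z * star u) * (z * star u) := by
      rw [abs_mul_abs, star_mul, star_star]; simp only [mul_assoc]

end CFC

end CStarAlgebra

/-! ### Two operators with `|T|` commuting with `A`. -/

namespace IsPolarDecomposition

open Adjointable

variable {𝔄 : Type*} [NonUnitalCStarAlgebra 𝔄] [PartialOrder 𝔄] [StarOrderedRing 𝔄]
variable {H : Type*} [NormedAddCommGroup H] [NormedSpace ℂ H] [SMul 𝔄 H] [CStarModule 𝔄 H]
  [CompleteSpace H] {T A UT UA C : Adjointable 𝔄 H} {α β : ℝ}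

theorem commute_projection (hA : IsPolarDecomposition A UA) (h1 : Commute C A)
    (h2 : Commute C (star A)) : Commute C (star UA * UA) :=
  Adjointable.commute_projection hA.isStarProjection hA.closedRange_projection_eq_star h2
    h1.star_star

theorem commute_partialIsometry (hA : IsPolarDecomposition A UA) (h1 : Commute C A)
    (h2 : Commute C (star A)) : Commute C UA := by
  have hg : Commute C (CFC.abs A) := by
    refine Commute.cfcAbs_right h1.symm ?_
    simpa using h2.star_star.symm
  -- The commutator `[C, U_A]` kills `|A|`, hence also `Q = U_A⋆U_A`; as `Q` commutes with `C` and
  -- `U_A Q = U_A`, it vanishes.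
  have hz : (C * UA - UA * C) * CFC.abs A = 0 := by
    rw [sub_mul, mul_assoc, ← hA.eq_mul_abs, mul_assoc, hg.eq, ← mul_assoc, ← hA.eq_mul_abs, h1.eq,
      sub_self]
  have hq := mul_eq_zero_of_closedRange_subset hA.closedRange_projection.subset hz
  have hU : UA * (star UA * UA) = UA := by rw [← mul_assoc, hA.partialIsometry]
  rwa [sub_mul, mul_assoc, hU, mul_assoc, (hA.commute_projection h1 h2).eq, ← mul_assoc, hU,
    sub_eq_zero] at hq

theorem _root_.Commute.cfcAbs_star_right (hTA : Commute (CFC.abs T) A) :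
    Commute (CFC.abs T) (star A) := by
  simpa [(CFC.abs_nonneg T).star_eq] using hTA.star_star

theorem _root_.Commute.cfcAbs_abs_right (hTA : Commute (CFC.abs T) A) :
    Commute (CFC.abs T) (CFC.abs A) := by
  refine Commute.cfcAbs_right hTA.symm ?_
  rw [(CFC.abs_nonneg T).star_eq]
  exact hTA.symm

theorem commute_abs_partialIsometry (hA : IsPolarDecomposition A UA)
    (hTA : Commute (CFC.abs T) A) : Commute (CFC.abs T) UA :=
  hA.commute_partialIsometry hTA hTA.cfcAbs_star_right

theorem commute_abs_projection (hA : IsPolarDecomposition A UA)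
    (hTA : Commute (CFC.abs T) A) : Commute (CFC.abs T) (star UA * UA) :=
  hA.commute_projection hTA hTA.cfcAbs_star_right

theorem commute_projection_of_abs (hT : IsPolarDecomposition T UT)
    (h1 : Commute (CFC.abs T) C) (h2 : Commute (CFC.abs T) (star C)) :
    Commute (star UT * UT) C :=
  (Adjointable.commute_projection hT.isStarProjection hT.closedRange_projection h1.symm
    h2.symm).symm

theorem commute_projection_partialIsometry (hT : IsPolarDecomposition T UT)
    (hA : IsPolarDecomposition A UA) (hTA : Commute (CFC.abs T) A) :
    Commute (star UT * UT) UA := by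
  have h := hA.commute_abs_partialIsometry hTA
  exact hT.commute_projection_of_abs h h.cfcAbs_star_right

theorem commute_projections (hT : IsPolarDecomposition T UT)
    (hA : IsPolarDecomposition A UA) (hTA : Commute (CFC.abs T) A) :
    Commute (star UT * UT) (star UA * UA) := by
  have h := hA.commute_abs_projection hTA
  exact hT.commute_projection_of_abs h h.cfcAbs_star_right

theorem isStarProjection_mul (hT : IsPolarDecomposition T UT)
    (hA : IsPolarDecomposition A UA) (hTA : Commute (CFC.abs T) A) :
    IsStarProjection (star UT * UT * (star UA * UA)) :=
  hT.isStarProjection.mul hA.isStarProjection (hT.commute_projections hA hTA)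

/-- The operator `|T|^α |A| |T⋆|^β`. -/
noncomputable def operatorZ (T A : Adjointable 𝔄 H) (α β : ℝ) : Adjointable 𝔄 H :=
  CFC.abs T ^ α * CFC.abs A * CFC.abs (star T) ^ β

theorem operatorZ_mul_projection (hT : IsPolarDecomposition T UT) (hβ : 0 < β) :
    operatorZ T A α β * (UT * star UT) = operatorZ T A α β := by
  have := hT.star.abs_rpow_mul_projection hβ
  rw [star_star] at this
  rw [operatorZ, mul_assoc, this]

theorem projection_mul_operatorZ (hA : IsPolarDecomposition A UA)
    (hTA : Commute (CFC.abs T) A) :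
    star UA * UA * operatorZ T A α β = operatorZ T A α β := by
  have h := (CFC.commute_rpow_left (hA.commute_abs_projection hTA) α).eq
  rw [operatorZ, ← mul_assoc, ← mul_assoc, ← h, mul_assoc (_ ^ α), hA.projection_mul_abs]

theorem projection_mul_operatorZ' (hT : IsPolarDecomposition T UT) (hα : 0 < α) :
    star UT * UT * operatorZ T A α β = operatorZ T A α β := by
  rw [operatorZ, ← mul_assoc, ← mul_assoc, hT.projection_mul_abs_rpow hα]

theorem operatorY_eq (hA : IsPolarDecomposition A UA) (hTA : Commute (CFC.abs T) A) :
    operatorY T A α β = UA * operatorZ T A α β := by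
  have h := (CFC.commute_rpow_left (hA.commute_abs_partialIsometry hTA) α).eq
  conv_lhs => rw [operatorY, hA.eq_mul_abs]
  rw [operatorZ, ← mul_assoc, ← mul_assoc, ← mul_assoc, ← h]

theorem star_mul_operatorY (hA : IsPolarDecomposition A UA) (hTA : Commute (CFC.abs T) A) :
    star UA * operatorY T A α β = operatorZ T A α β := by
  rw [hA.operatorY_eq hTA, ← mul_assoc, hA.projection_mul_operatorZ hTA]

theorem abs_operatorY (hA : IsPolarDecomposition A UA) (hTA : Commute (CFC.abs T) A) :
    CFC.abs (operatorY T A α β) = CFC.abs (operatorZ T A α β) := by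
  have : star (operatorY T A α β) * operatorY T A α β
      = star (operatorZ T A α β) * operatorZ T A α β := by
    conv_lhs => rw [hA.operatorY_eq hTA, star_mul, mul_assoc, ← mul_assoc (star UA),
      hA.projection_mul_operatorZ hTA]
  rw [CFC.abs, this, CFC.abs]

theorem projection_mul_abs_operatorZ (hT : IsPolarDecomposition T UT) (hβ : 0 < β) :
    UT * star UT * CFC.abs (operatorZ T A α β) = CFC.abs (operatorZ T A α β) :=
  CFC.projection_mul_abs hT.isStarProjection' (hT.operatorZ_mul_projection hβ)

theorem operatorY_eq_iff (hT : IsPolarDecomposition T UT) (hA : IsPolarDecomposition A UA)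
    (hTA : Commute (CFC.abs T) A) (hα : 0 < α) (hβ : 0 < β) :
    operatorY T A α β = operatorW UT UA * star UT * CFC.abs (operatorY T A α β) ↔
      0 ≤ operatorZ T A α β := by
  rw [operatorW, mul_assoc _ UT (star UT), hA.abs_operatorY hTA, mul_assoc (_ * UA),
    hT.projection_mul_abs_operatorZ hβ, (hT.commute_projection_partialIsometry hA hTA).eq]
  constructor
  · intro h
    -- Left multiplication by `U_A⋆` turns the equation into `Z = PQ|Z|` with `PQ` a projection.
    have h1 := congrArg (star UA * ·) h
    simp only [hA.star_mul_operatorY hTA] at h1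
    rw [← mul_assoc, ← mul_assoc, ← (hT.commute_projections hA hTA).eq] at h1
    rw [CFC.eq_abs_of_eq_projection_mul_abs (hT.isStarProjection_mul hA hTA) h1]
    exact CFC.abs_nonneg _
  · intro h
    rw [CFC.abs_of_nonneg _ h, mul_assoc, hT.projection_mul_operatorZ' hα, hA.operatorY_eq hTA]

theorem operatorX_mul_projection (hT : IsPolarDecomposition T UT) (hβ : 0 < β) :
    operatorX T A UT α β * (star UT * UT) = operatorX T A UT α β := by
  rw [operatorX, mul_assoc, hT.abs_rpow_mul_projection hβ]

theorem operatorX_mul_star (hT : IsPolarDecomposition T UT) (hβ : 0 < β) :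
    operatorX T A UT α β * star UT = operatorY T A α β := by
  have := hT.star.abs_rpow_mul_projection hβ
  rw [star_star] at this
  rw [operatorX, operatorY, mul_assoc _ UT, hT.mul_abs_rpow hβ, mul_assoc, mul_assoc _ UT, this]

/-- Right multiplication by `U_T⋆` carries the first equation to the second, and multiplication by
`U_T` carries it back, because `U_T⋆U_T` acts as a right identity on both `X` and `|X|`. -/
theorem operatorX_eq_iff (hT : IsPolarDecomposition T UT) (hβ : 0 < β) :
    operatorX T A UT α β = operatorW UT UA * CFC.abs (operatorX T A UT α β) ↔
      operatorY T A α β = operatorW UT UA * star UT * CFC.abs (operatorY T A α β) := by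
  have hP := hT.operatorX_mul_projection (A := A) (α := α) hβ
  have h1 := CFC.projection_mul_abs hT.isStarProjection hP
  have h2 := congrArg star h1
  rw [star_mul, hT.isStarProjection.isSelfAdjoint.star_eq, (CFC.abs_nonneg _).star_eq] at h2
  have h3 : operatorW UT UA * star UT * CFC.abs (operatorY T A α β)
      = operatorW UT UA * CFC.abs (operatorX T A UT α β) * star UT := by
    rw [← hT.operatorX_mul_star hβ, CFC.abs_mul_star hT.isStarProjection hP]
    calc _ = operatorW UT UA * (star UT * UT * CFC.abs (operatorX T A UT α β)) * star UT := by
          simp only [mul_assoc]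
      _ = _ := by rw [h1]
  rw [h3, ← hT.operatorX_mul_star hβ]
  constructor
  · exact fun h => congrArg (· * star UT) h
  · intro h
    have h4 := congrArg (· * UT) h
    rwa [mul_assoc, hP, mul_assoc, mul_assoc, h2] at h4

/-! ### Consequences of the positivity of `|T|^α |A| |T⋆|^β`. -/

theorem commute_of_operatorZ_nonneg (hTA : Commute (CFC.abs T) A) (hβ : 0 < β)
    (h : 0 ≤ operatorZ T A α β) :
    Commute (CFC.abs (star T)) (CFC.abs T ^ α * CFC.abs A) := by
  have hc : 0 ≤ CFC.abs T ^ α * CFC.abs A :=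
    (CFC.commute_rpow_left hTA.cfcAbs_abs_right α).mul_nonneg CFC.rpow_nonneg (CFC.abs_nonneg A)
  -- A product of two positive elements is positive exactly when they commute; the exponent `β` is
  -- then removed by taking a root.
  exact CFC.commute_of_rpow_left (CFC.abs_nonneg _) hβ
    ((commute_iff_mul_nonneg hc CFC.rpow_nonneg).2 h).symm

theorem operatorZ_nonneg_of_commute (hTA : Commute (CFC.abs T) A)
    (h : Commute (CFC.abs (star T)) (CFC.abs T ^ α * CFC.abs A)) :
    0 ≤ operatorZ T A α β := by
  have hc : 0 ≤ CFC.abs T ^ α * CFC.abs A :=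
    (CFC.commute_rpow_left hTA.cfcAbs_abs_right α).mul_nonneg CFC.rpow_nonneg (CFC.abs_nonneg A)
  exact (CFC.commute_rpow_left h β).symm.mul_nonneg hc CFC.rpow_nonneg

theorem operatorZ_nonneg_of_operatorZ_nonneg (hA : IsPolarDecomposition A UA)
    (hTA : Commute (CFC.abs T) A) (hTA' : Commute (CFC.abs (star T)) (CFC.abs A))
    {α' β' : ℝ} (hα : 0 < α) (hβ : 0 < β) (h : 0 ≤ operatorZ T A α β) :
    0 ≤ operatorZ T A α' β' := by
  refine operatorZ_nonneg_of_commute hTA ?_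
  have h1 := commute_of_operatorZ_nonneg hTA hβ h
  set a := CFC.abs T
  set b := CFC.abs (star T)
  set g := CFC.abs A
  set q := star UA * UA
  have haq : Commute a q := hA.commute_abs_projection hTA
  have hqg : q * g = g := hA.projection_mul_abs
  -- The commutator of `b` and `a^α` kills `g`, so it kills `q`. With `q` in place of `g`, `a^α`
  -- commutes with `b * q`, where `α` can be exchanged for `α'`.
  have hz : (b * a ^ α - a ^ α * b) * g = 0 := by
    rw [sub_mul, mul_assoc, h1.eq, mul_assoc, mul_assoc, hTA'.eq, sub_self]
  have hz' := mul_eq_zero_of_closedRange_subset hA.closedRange_projection.subset hz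
  rw [sub_mul, sub_eq_zero] at hz'
  have h2 : Commute (a ^ α) (b * q) := by
    have := (CFC.commute_rpow_left haq α).eq
    rw [Commute, SemiconjBy, ← mul_assoc, ← hz', mul_assoc, mul_assoc]
    exact congrArg (b * ·) this
  have h3 : Commute (a ^ α') (b * q) := CFC.commute_rpow_left (CFC.commute_of_rpow_left (CFC.abs_nonneg T) hα h2) α'
  calc b * (a ^ α' * g) = b * (a ^ α' * (q * g)) := by rw [hqg]
    _ = b * q * a ^ α' * g := by
      rw [← mul_assoc (_ ^ α'), (CFC.commute_rpow_left haq α').eq]; simp only [mul_assoc]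
    _ = a ^ α' * (b * (q * g)) := by rw [← h3.eq]; simp only [mul_assoc]
    _ = a ^ α' * g * b := by rw [hqg, hTA'.eq, mul_assoc]

/-- Only a right factor can be exchanged for one with the same closed range, so each factor is
commuted to the right before it is replaced. -/
theorem closedRange_projections (hT : IsPolarDecomposition T UT) (hA : IsPolarDecomposition A UA)
    (hTA : Commute (CFC.abs T) A) (hα : 0 < α) :
    closedRange (star UT * UT * (star UA * UA)) = closedRange (CFC.abs T ^ α * CFC.abs A) := by
  rw [← closedRange_mul_congr _ hA.closedRange_projection,
    (CFC.commute_rpow_left (hA.commute_abs_projection hTA) α).eq,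
    closedRange_mul_congr _ (closedRange_rpow (CFC.abs_nonneg T) hα),
    ← closedRange_mul_congr _ hT.closedRange_projection, (hT.commute_projections hA hTA).eq]

theorem commute_projection_of_operatorZ_nonneg (hT : IsPolarDecomposition T UT)
    (hTA : Commute (CFC.abs T) A) (hβ : 0 < β) (h : 0 ≤ operatorZ T A α β) :
    Commute (UT * star UT) (CFC.abs T ^ α * CFC.abs A) := by
  have h1 := commute_of_operatorZ_nonneg hTA hβ h
  simpa only [star_star] using hT.star.commute_projection_of_abs h1 h1.cfcAbs_star_right

theorem commute_projections_of_operatorZ_nonneg (hT : IsPolarDecomposition T UT)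
    (hA : IsPolarDecomposition A UA) (hTA : Commute (CFC.abs T) A) (hα : 0 < α) (hβ : 0 < β)
    (h : 0 ≤ operatorZ T A α β) :
    Commute (UT * star UT) (star UT * UT * (star UA * UA)) := by
  have h1 := hT.commute_projection_of_operatorZ_nonneg hTA hβ h
  refine Adjointable.commute_projection (hT.isStarProjection_mul hA hTA)
    (hT.closedRange_projections hA hTA hα) h1 ?_
  rwa [hT.isStarProjection'.isSelfAdjoint.star_eq]

/-- Since `P` commutes with `U_A`, `W = U_A P U_T`, and `PQP = PQ`. -/
theorem star_operatorW_mul_self (hT : IsPolarDecomposition T UT) (hA : IsPolarDecomposition A UA)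
    (hTA : Commute (CFC.abs T) A) :
    star (operatorW UT UA) * operatorW UT UA
      = star UT * (star UT * UT * (star UA * UA)) * UT := by
  rw [operatorW, (hT.commute_projection_partialIsometry hA hTA).eq]
  calc _ = star UT * (star (star UT * UT) * (star UA * UA) * (star UT * UT)) * UT := by
        simp only [star_mul, mul_assoc]
    _ = _ := by
      rw [hT.isStarProjection.isSelfAdjoint.star_eq, mul_assoc (star UT * UT),
        ← (hT.commute_projections hA hTA).eq, ← mul_assoc (star UT * UT) (star UT * UT),
        hT.isStarProjection.isIdempotentElem.eq]

theorem closedRange_star_operatorY (hA : IsPolarDecomposition A UA)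
    (hTA : Commute (CFC.abs T) A) :
    closedRange (star (operatorY T A α β))
      = closedRange (CFC.abs (star T) ^ β * (CFC.abs T ^ α * CFC.abs A)) := by
  rw [operatorY, star_mul, star_mul, (CFC.rpow_nonneg (a := CFC.abs T)).star_eq,
    (CFC.rpow_nonneg (a := CFC.abs (star T))).star_eq,
    ← (CFC.commute_rpow_left hTA.cfcAbs_star_right α).eq, ← mul_assoc, ← mul_assoc,
    closedRange_mul_congr _ hA.closedRange_abs]

theorem closedRange_star_operatorY_of_nonneg (hT : IsPolarDecomposition T UT)
    (hA : IsPolarDecomposition A UA) (hTA : Commute (CFC.abs T) A) (hα : 0 < α) (hβ : 0 < β)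
    (h : 0 ≤ operatorZ T A α β) :
    closedRange (star (operatorY T A α β))
      = closedRange (UT * star UT * (star UT * UT * (star UA * UA))) := by
  have h1 := CFC.commute_rpow_left (commute_of_operatorZ_nonneg hTA hβ h) β
  have hP := hT.star.closedRange_projection
  rw [star_star] at hP
  rw [hA.closedRange_star_operatorY hTA, h1.eq,
    closedRange_mul_congr _ (closedRange_rpow (CFC.abs_nonneg (star T)) hβ),
    ← closedRange_mul_congr _ hP, ← (hT.commute_projection_of_operatorZ_nonneg hTA hβ h).eq,
    closedRange_mul_congr _ (hT.closedRange_projections hA hTA hα)]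

theorem star_mul_projection (hT : IsPolarDecomposition T UT) :
    star UT * (UT * star UT) = star UT := by
  rw [← mul_assoc]
  simpa only [star_star] using hT.star.partialIsometry

theorem operatorY_mul (hT : IsPolarDecomposition T UT) (hβ : 0 < β) :
    operatorY T A α β * UT = operatorX T A UT α β := by
  rw [← hT.operatorX_mul_star hβ, mul_assoc, hT.operatorX_mul_projection hβ]

theorem isPolarDecomposition_operatorX (hT : IsPolarDecomposition T UT)
    (hA : IsPolarDecomposition A UA) (hTA : Commute (CFC.abs T) A) (hα : 0 < α) (hβ : 0 < β)
    (h : 0 ≤ operatorZ T A α β) :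
    IsPolarDecomposition (operatorX T A UT α β) (operatorW UT UA) := by
  have hc := hT.commute_projections_of_operatorZ_nonneg hA hTA hα hβ h
  have he := hT.isStarProjection_mul hA hTA
  have hp := isStarProjection_conj hT.partialIsometry he hc
  refine ⟨?_, ?_, ?_⟩
  · refine mul_star_mul_self_of_isStarProjection ?_
    rwa [hT.star_operatorW_mul_self hA hTA]
  · rw [hT.operatorX_eq_iff hβ, hT.operatorY_eq_iff hA hTA hα hβ]
    exact h
  · rw [isProjectionOnto_closedRange_iff, hT.star_operatorW_mul_self hA hTA]
    refine ⟨hp, ?_⟩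
    rw [← hT.operatorY_mul hβ, star_mul,
      closedRange_mul_congr _ (hT.closedRange_star_operatorY_of_nonneg hA hTA hα hβ h),
      ← mul_assoc (star UT) (UT * star UT), hT.star_mul_projection]
    refine (closedRange_mul_subset _ _).antisymm ?_
    -- With `e = PQ` commuting with `U_T U_T⋆`, `U_T⋆ e = (U_T⋆ e U_T) U_T⋆`, which gives the
    -- reverse inclusion of ranges.
    have : star UT * (star UT * UT * (star UA * UA))
        = star UT * (star UT * UT * (star UA * UA)) * UT * star UT := by
      generalize star UT * UT * (star UA * UA) = e at hc
      rw [mul_assoc _ UT, mul_assoc (star UT), ← hc.eq, ← mul_assoc (star UT) (UT * star UT),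
        hT.star_mul_projection]
    conv_lhs => rw [this]
    exact closedRange_mul_subset _ _

theorem isPolarDecomposition_operatorY (hT : IsPolarDecomposition T UT)
    (hA : IsPolarDecomposition A UA) (hTA : Commute (CFC.abs T) A) (hα : 0 < α) (hβ : 0 < β)
    (h : 0 ≤ operatorZ T A α β) :
    IsPolarDecomposition (operatorY T A α β) (operatorW UT UA * star UT) := by
  have hc := hT.commute_projections_of_operatorZ_nonneg hA hTA hα hβ h
  have he := hT.isStarProjection_mul hA hTA
  have e : star (operatorW UT UA * star UT) * (operatorW UT UA * star UT)
      = UT * star UT * (star UT * UT * (star UA * UA)) := by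
    calc _ = UT * (star (operatorW UT UA) * operatorW UT UA) * star UT := by
          rw [star_mul, star_star]; simp only [mul_assoc]
      _ = UT * star UT * ((star UT * UT * (star UA * UA)) * (UT * star UT)) := by
          rw [hT.star_operatorW_mul_self hA hTA]; simp only [mul_assoc]
      _ = _ := by rw [← hc.eq, ← mul_assoc, hT.isStarProjection'.isIdempotentElem.eq]
  have hp := hT.isStarProjection'.mul he hc
  refine ⟨?_, ?_, ?_⟩
  · refine mul_star_mul_self_of_isStarProjection ?_
    rwa [e]
  · rw [hT.operatorY_eq_iff hA hTA hα hβ]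
    exact h
  · rw [isProjectionOnto_closedRange_iff, e]
    exact ⟨hp, (hT.closedRange_star_operatorY_of_nonneg hA hTA hα hβ h).symm⟩

end IsPolarDecomposition

theorem corollary4p11
    {𝔄 : Type*} [NonUnitalCStarAlgebra 𝔄] [PartialOrder 𝔄] [StarOrderedRing 𝔄]
    {H : Type*} [NormedAddCommGroup H] [NormedSpace ℂ H] [SMul 𝔄 H] [CStarModule 𝔄 H]
    [CompleteSpace H]
    (T A UT UA : Adjointable 𝔄 H)
    (hT : IsPolarDecomposition T UT) (hA : IsPolarDecomposition A UA)
    (hTA : Commute (CFC.abs T) A) :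
    (∀ α β : ℝ, 0 < α → 0 < β →
      List.TFAE [
        IsPolarDecomposition (operatorX T A UT α β) (operatorW UT UA),
        IsPolarDecomposition (operatorY T A α β) (operatorW UT UA * star UT),
        operatorX T A UT α β = operatorW UT UA * CFC.abs (operatorX T A UT α β),
        operatorY T A α β = operatorW UT UA * star UT * CFC.abs (operatorY T A α β),
        0 ≤ CFC.abs T ^ α * CFC.abs A * CFC.abs (star T) ^ β]) ∧
    (Commute (CFC.abs (star T)) (CFC.abs A) →
      ∀ α β α' β' : ℝ, 0 < α → 0 < β → 0 < α' → 0 < β' →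
        (IsPolarDecomposition (operatorX T A UT α β) (operatorW UT UA) ∨
          IsPolarDecomposition (operatorY T A α β) (operatorW UT UA * star UT) ∨
          operatorX T A UT α β = operatorW UT UA * CFC.abs (operatorX T A UT α β) ∨
          operatorY T A α β = operatorW UT UA * star UT * CFC.abs (operatorY T A α β) ∨
          0 ≤ CFC.abs T ^ α * CFC.abs A * CFC.abs (star T) ^ β) →
        (IsPolarDecomposition (operatorX T A UT α' β') (operatorW UT UA) ∧
          IsPolarDecomposition (operatorY T A α' β') (operatorW UT UA * star UT) ∧
          operatorX T A UT α' β' = operatorW UT UA * CFC.abs (operatorX T A UT α' β') ∧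
          operatorY T A α' β' = operatorW UT UA * star UT * CFC.abs (operatorY T A α' β') ∧
          0 ≤ CFC.abs T ^ α' * CFC.abs A * CFC.abs (star T) ^ β')) := by
  have tfae : ∀ α β : ℝ, 0 < α → 0 < β →
      List.TFAE [
        IsPolarDecomposition (operatorX T A UT α β) (operatorW UT UA),
        IsPolarDecomposition (operatorY T A α β) (operatorW UT UA * star UT),
        operatorX T A UT α β = operatorW UT UA * CFC.abs (operatorX T A UT α β),
        operatorY T A α β = operatorW UT UA * star UT * CFC.abs (operatorY T A α β),
        0 ≤ CFC.abs T ^ α * CFC.abs A * CFC.abs (star T) ^ β] := by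
    intro α β hα hβ
    tfae_have 1 → 3 := fun h => h.eq_mul_abs
    tfae_have 2 → 4 := fun h => h.eq_mul_abs
    tfae_have 3 ↔ 4 := hT.operatorX_eq_iff hβ
    tfae_have 4 ↔ 5 := hT.operatorY_eq_iff hA hTA hα hβ
    tfae_have 5 → 1 := hT.isPolarDecomposition_operatorX hA hTA hα hβ
    tfae_have 5 → 2 := hT.isPolarDecomposition_operatorY hA hTA hα hβ
    tfae_finish
  refine ⟨tfae, fun hc α β α' β' hα hβ hα' hβ' h => ?_⟩
  have h1 := tfae α β hα hβ
  have h2 := tfae α' β' hα' hβ'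
  have h5 : 0 ≤ CFC.abs T ^ α * CFC.abs A * CFC.abs (star T) ^ β := by
    rcases h with h | h | h | h | h
    · exact (h1.out 0 4).1 h
    · exact (h1.out 1 4).1 h
    · exact (h1.out 2 4).1 h
    · exact (h1.out 3 4).1 h
    · exact h
  have h5' : 0 ≤ CFC.abs T ^ α' * CFC.abs A * CFC.abs (star T) ^ β' :=
    hA.operatorZ_nonneg_of_operatorZ_nonneg hTA hc hα hβ h5
  exact ⟨(h2.out 0 4).2 h5', (h2.out 1 4).2 h5', (h2.out 2 4).2 h5', (h2.out 3 4).2 h5', h5'⟩
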